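/- Let $f:\mathbb{R}\to\mathbb{C}$ be $2\pi$-periodic and integrable over $[-\pi,\pi]$. Write $\hat f(k)=\frac1{2\pi}\int_{-\pi}^{\pi}f(x)e^{-ikx}\,dx$ for $k\in\mathbb{Z}$, $S_n(f)(x)=\sum_{k=-n}^{n}\hat f(k)e^{ikx}$, and $\|g\|_L=\int_{-\pi}^{\pi}|g(x)|\,dx$. A complex sequence $(c_n)_{n\ge 0}$ is said to belong to the class NBVS if there is $\theta_0\in[0,\pi/2)$ such that for every $n\ge 1$ either $c_n=0$ or $|\arg c_n|\le\theta_0$, and there is a constant $K>0$ (depending only on the sequence) such that \[ \sum_{n=m}^{2m}|c_n-c_{n+1}|\le K\bigl(|c_m|+|c_{2m}|\bigr)\qquad\text{for all } m=1,2,\dots \] Suppose that both sequences $(\hat f(n))_{n\ge 0}$ and $(\hat f(-n))_{n\ge 0}$ belong to NBVS. Then \[ \lim_{n\to\infty}\|f-S_n(f)\|_L=0\quad\text{if and only if}\quad \lim_{|n|\to\infty}\hat f(n)\log|n|=0, \] where on the right $n$ ranges over all integers, that is, the limit is $0$ both as $n\to+\infty$ and as $n\to-\infty$. -/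

import Mathlib

open Filter Topology MeasureTheory

noncomputable section

/-- The closed sector `M(θ₀) = {z : |arg z| ≤ θ₀}` (it contains `0`, since `Complex.arg 0 = 0`). -/
def sector (θ₀ : ℝ) : Set ℂ := {z : ℂ | |Complex.arg z| ≤ θ₀}

/-- The class `NBVS`: the terms `c n`, `n ≥ 1`, lie in one sector `M(θ₀)` with `0 ≤ θ₀ < π / 2`, and
there is a positive constant `K`, depending only on the sequence, such that
`∑_{n=m}^{2m} |Δ c n| ≤ K (|c m| + |c (2m)|)` for all `m ≥ 1`, where `Δ c n = c n - c (n+1)`. -/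
def NBVS (c : ℕ → ℂ) : Prop :=
  (∃ θ₀ : ℝ, 0 ≤ θ₀ ∧ θ₀ < Real.pi / 2 ∧ ∀ n : ℕ, 1 ≤ n → c n ∈ sector θ₀) ∧
  ∃ K : ℝ, 0 < K ∧ ∀ m : ℕ, 1 ≤ m →
    ∑ n ∈ Finset.Icc m (2 * m), ‖c n - c (n + 1)‖ ≤ K * (‖c m‖ + ‖c (2 * m)‖)

/-- The complex Fourier coefficient `f̂(k)` of a function of period `2π`. -/
def fourierHat (f : ℝ → ℂ) (k : ℤ) : ℂ :=
  fourierCoeffOn (neg_lt_self Real.pi_pos) f k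

/-- `f̂(k) = (1 / 2π) ∫_{-π}^{π} f(x) e^{-ikx} dx`. -/
theorem fourierHat_eq (f : ℝ → ℂ) (k : ℤ) :
    fourierHat f k = (1 / (2 * Real.pi) : ℂ) *
      ∫ x in (-Real.pi)..Real.pi, f x * Complex.exp (-(Complex.I * k * x)) := by
  have hpi : (Real.pi : ℂ) ≠ 0 := by exact_mod_cast Real.pi_ne_zero
  unfold fourierHat
  rw [fourierCoeffOn_eq_integral, Complex.real_smul]
  congr 1
  · push_cast
    ring
  · refine intervalIntegral.integral_congr fun x _ => ?_
    simp only [fourier_coe_apply, smul_eq_mul]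
    rw [mul_comm]
    congr 2
    push_cast
    field_simp
    ring

/-- The symmetric partial sum `S_n(f, x) = ∑_{k=-n}^{n} f̂(k) e^{ikx}`. -/
def partialSum (f : ℝ → ℂ) (n : ℕ) (x : ℝ) : ℂ :=
  ∑ k ∈ Finset.Icc (-(n : ℤ)) n, fourierHat f k * Complex.exp (Complex.I * k * x)

/-- The norm `‖g‖_L = ∫_{-π}^{π} |g(x)| dx`. -/
def normL (g : ℝ → ℂ) : ℝ := ∫ x in (-Real.pi)..Real.pi, ‖g x‖

/-- `L_{2π}`: the complex-valued functions of period `2π`, integrable over a period. -/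
def PeriodicIntegrable (f : ℝ → ℂ) : Prop :=
  Function.Periodic f (2 * Real.pi) ∧ IntervalIntegrable f volume (-Real.pi) Real.pi

end

/-! Sufficiency. Let `T` be a trigonometric polynomial of degree at most `n`, so that `S_m T = T`
for `m ≥ n`. Averaging over `n ≤ m < 2n` writes `f - S_n f` as the mean of `(f - T) - S_m (f - T)`
plus the mean of the blocks `S_m f - S_n f`. Positivity of the Fejér kernel bounds the first mean by
`4 ‖f - T‖`, which is small by density (`normL_sub_partialSum_le`). For the blocks, Abel summation
and the `O(log p)` bound on the `L¹` norm of `∑_{j<p} e^{ijx}` give `log n` times coefficient sizes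
and variations over `[n, 2n]`. NBVS replaces the variation by `|c_n| + |c_{2n}|` (`normL_block_le`,
`NBVS.tendsto_block_bound`).

Necessity. The sawtooth `x - π` on `[0, 2π]` is bounded and its Fourier coefficients are of exact
order `1/k`. Testing `S_{2n} f - S_n f` against its modulation by `e^{-inx}` shows that `∑_{n<k≤2n}
f̂(k)/(k-n)` tends to `0` (`norm_sum_fourierHat_div_le`). The sector condition excludes
cancellation, so the same holds with `|f̂(k)|`. NBVS gives `|c_n| ≤ (K+1)(|c_j| + |c_{2j}|)` for `j
≤ n ≤ 2j`; summing over `M < j ≤ 2M`, `M = ⌊n/2⌋`, with weights `1/(j-M)` of total at least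
`log(M+1)` bounds `|c_n| log n` (`norm_mul_log_le`). Negative frequencies follow by reflecting `f`.
-/

/-! ### Exponentials and their integrals over a period -/

/-- The exponential `e^{ikx}`. -/
noncomputable def wave (k : ℤ) (x : ℝ) : ℂ := Complex.exp (Complex.I * k * x)

theorem norm_wave (k : ℤ) (x : ℝ) : ‖wave k x‖ = 1 := by
  have h : Complex.I * k * x = ((k * x : ℝ) : ℂ) * Complex.I := by push_cast; ring
  rw [wave, h, Complex.norm_exp_ofReal_mul_I]

@[fun_prop]
theorem continuous_wave (k : ℤ) : Continuous (wave k) := by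
  unfold wave; fun_prop

theorem wave_zero (x : ℝ) : wave 0 x = 1 := by simp [wave]

theorem wave_add (k l : ℤ) (x : ℝ) : wave (k + l) x = wave k x * wave l x := by
  rw [wave, wave, wave, ← Complex.exp_add]; push_cast; ring_nf

theorem wave_sub_right (k : ℤ) (x y : ℝ) : wave k (x - y) = wave k x * wave (-k) y := by
  rw [wave, wave, wave, ← Complex.exp_add]; push_cast; ring_nf

theorem wave_neg_right (k : ℤ) (x : ℝ) : wave k (-x) = wave (-k) x := by
  simp [wave]

theorem wave_natCast (k : ℕ) (x : ℝ) : wave k x = Complex.exp (Complex.I * x) ^ k := by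
  rw [wave, ← Complex.exp_nat_mul]; push_cast; ring_nf

theorem conj_wave (k : ℤ) (x : ℝ) : (starRingEnd ℂ) (wave k x) = wave (-k) x := by
  rw [wave, wave, ← Complex.exp_conj]; simp

theorem wave_periodic (k : ℤ) : Function.Periodic (wave k) (2 * Real.pi) := by
  intro x
  rw [wave, wave, Complex.exp_eq_exp_iff_exists_int]
  exact ⟨k, by push_cast; ring⟩

theorem wave_hasDerivAt (k : ℤ) (x : ℝ) : HasDerivAt (wave k) (Complex.I * k * wave k x) x := by
  have h : HasDerivAt (fun y : ℝ => Complex.I * k * (y : ℂ)) (Complex.I * k) x := by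
    simpa using (Complex.ofRealCLM.hasDerivAt (x := x)).const_mul (Complex.I * k)
  exact h.cexp.congr_deriv (mul_comm _ _)

theorem integral_wave (k : ℤ) :
    ∫ x in (-Real.pi)..Real.pi, wave k x = if k = 0 then 2 * (Real.pi : ℂ) else 0 := by
  split_ifs with hk
  · subst hk
    simp only [wave_zero, intervalIntegral.integral_const, Complex.real_smul]
    push_cast; ring
  · have hk' : Complex.I * (k : ℂ) ≠ 0 := mul_ne_zero Complex.I_ne_zero (by exact_mod_cast hk)
    have hd : ∀ x ∈ Set.uIcc (-Real.pi) Real.pi,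
        HasDerivAt (fun x => (Complex.I * k)⁻¹ * wave k x) (wave k x) x := fun x _ => by
      have := (wave_hasDerivAt k x).const_mul (Complex.I * k)⁻¹
      rwa [inv_mul_cancel_left₀ hk'] at this
    rw [intervalIntegral.integral_eq_sub_of_hasDerivAt hd
      ((continuous_wave k).intervalIntegrable _ _)]
    have := wave_periodic k (-Real.pi)
    rw [show -Real.pi + 2 * Real.pi = Real.pi by ring] at this
    rw [this, sub_self]

theorem partialSum_eq (f : ℝ → ℂ) (n : ℕ) (x : ℝ) :
    partialSum f n x = ∑ k ∈ Finset.Icc (-(n : ℤ)) n, fourierHat f k * wave k x := rfl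

theorem continuous_partialSum (f : ℝ → ℂ) (n : ℕ) : Continuous (partialSum f n) := by
  have : partialSum f n = fun x => ∑ k ∈ Finset.Icc (-(n : ℤ)) n, fourierHat f k * wave k x := rfl
  rw [this]
  exact continuous_finsetSum _ fun k _ => continuous_const.mul (continuous_wave k)

theorem fourierHat_eq_wave (f : ℝ → ℂ) (k : ℤ) :
    fourierHat f k = (1 / (2 * Real.pi) : ℂ) *
      ∫ x in (-Real.pi)..Real.pi, f x * wave (-k) x := by
  rw [fourierHat_eq]; simp [wave]

/-! ### The `L¹` norm over a period -/

theorem neg_pi_le_pi : -Real.pi ≤ Real.pi := by linarith [Real.pi_pos]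

theorem normL_nonneg (g : ℝ → ℂ) : 0 ≤ normL g :=
  intervalIntegral.integral_nonneg neg_pi_le_pi fun _ _ => norm_nonneg _

theorem normL_add_le {f g : ℝ → ℂ} (hf : IntervalIntegrable f volume (-Real.pi) Real.pi)
    (hg : IntervalIntegrable g volume (-Real.pi) Real.pi) :
    normL (fun x => f x + g x) ≤ normL f + normL g := by
  unfold normL
  rw [← intervalIntegral.integral_add hf.norm hg.norm]
  exact intervalIntegral.integral_mono_on neg_pi_le_pi (hf.add hg).norm (hf.norm.add hg.norm)
    fun x _ => norm_add_le _ _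

theorem normL_sub_le {f g : ℝ → ℂ} (hf : IntervalIntegrable f volume (-Real.pi) Real.pi)
    (hg : IntervalIntegrable g volume (-Real.pi) Real.pi) :
    normL (fun x => f x - g x) ≤ normL f + normL g := by
  have := normL_add_le hf hg.neg
  simpa [normL, sub_eq_add_neg] using this

theorem normL_const_mul (c : ℂ) (f : ℝ → ℂ) : normL (fun x => c * f x) = ‖c‖ * normL f := by
  simp [normL]

theorem intervalIntegrable_sum {ι : Type*} (s : Finset ι) {f : ι → ℝ → ℂ}
    (hf : ∀ i ∈ s, IntervalIntegrable (f i) volume (-Real.pi) Real.pi) :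
    IntervalIntegrable (fun x => ∑ i ∈ s, f i x) volume (-Real.pi) Real.pi := by
  simpa only [← Finset.sum_apply] using IntervalIntegrable.sum s hf

theorem normL_sum_le {ι : Type*} (s : Finset ι) {f : ι → ℝ → ℂ}
    (hf : ∀ i ∈ s, IntervalIntegrable (f i) volume (-Real.pi) Real.pi) :
    normL (fun x => ∑ i ∈ s, f i x) ≤ ∑ i ∈ s, normL (f i) := by
  classical
  induction s using Finset.induction_on with
  | empty => simp [normL]
  | insert a s ha ih =>
    simp only [Finset.sum_insert ha]
    have h1 : IntervalIntegrable (fun x => ∑ i ∈ s, f i x) volume (-Real.pi) Real.pi :=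
      intervalIntegrable_sum s fun i hi => hf i (Finset.mem_insert_of_mem hi)
    have := normL_add_le (hf a (Finset.mem_insert_self _ _)) h1
    linarith [ih fun i hi => hf i (Finset.mem_insert_of_mem hi)]

theorem norm_fourierHat_le (f : ℝ → ℂ) (k : ℤ) :
    ‖fourierHat f k‖ ≤ 1 / (2 * Real.pi) * normL f := by
  rw [fourierHat_eq_wave, norm_mul]
  have h1 : ‖(1 / (2 * Real.pi) : ℂ)‖ = 1 / (2 * Real.pi) := by
    simp [abs_of_pos Real.pi_pos]
  rw [h1]
  refine mul_le_mul_of_nonneg_left ?_ (by positivity)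
  refine (intervalIntegral.norm_integral_le_integral_norm neg_pi_le_pi).trans_eq ?_
  simp [normL, norm_wave]

/-! ### Linearity of the Fourier coefficients and partial sums -/

theorem intervalIntegrable_mul_wave {f : ℝ → ℂ}
    (hf : IntervalIntegrable f volume (-Real.pi) Real.pi) (k : ℤ) :
    IntervalIntegrable (fun x => f x * wave k x) volume (-Real.pi) Real.pi :=
  hf.mul_continuousOn (continuous_wave k).continuousOn

theorem fourierHat_sub {f g : ℝ → ℂ} (hf : IntervalIntegrable f volume (-Real.pi) Real.pi)
    (hg : IntervalIntegrable g volume (-Real.pi) Real.pi) (k : ℤ) :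
    fourierHat (fun x => f x - g x) k = fourierHat f k - fourierHat g k := by
  simp only [fourierHat_eq_wave, sub_mul]
  rw [intervalIntegral.integral_sub (intervalIntegrable_mul_wave hf _)
    (intervalIntegrable_mul_wave hg _), mul_sub]

theorem fourierHat_trigPoly (s : Finset ℤ) (a : ℤ → ℂ) (k : ℤ) :
    fourierHat (fun x => ∑ j ∈ s, a j * wave j x) k = if k ∈ s then a k else 0 := by
  rw [fourierHat_eq_wave]
  simp only [Finset.sum_mul]
  rw [intervalIntegral.integral_finsetSum fun j _ => Continuous.intervalIntegrable
    (by fun_prop) _ _]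
  simp only [mul_assoc, ← wave_add, intervalIntegral.integral_const_mul, integral_wave]
  have hpi : (Real.pi : ℂ) ≠ 0 := by exact_mod_cast Real.pi_ne_zero
  simp only [mul_ite, mul_zero, add_neg_eq_zero, Finset.sum_ite_eq']
  split_ifs
  · field_simp
  · simp

theorem partialSum_sub {f g : ℝ → ℂ} (hf : IntervalIntegrable f volume (-Real.pi) Real.pi)
    (hg : IntervalIntegrable g volume (-Real.pi) Real.pi) (n : ℕ) (x : ℝ) :
    partialSum (fun x => f x - g x) n x = partialSum f n x - partialSum g n x := by
  simp only [partialSum_eq, fourierHat_sub hf hg, sub_mul, Finset.sum_sub_distrib]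

theorem partialSum_trigPoly {s : Finset ℤ} {n : ℕ} (hs : s ⊆ Finset.Icc (-(n : ℤ)) n)
    (a : ℤ → ℂ) (x : ℝ) :
    partialSum (fun x => ∑ j ∈ s, a j * wave j x) n x = ∑ j ∈ s, a j * wave j x := by
  simp only [partialSum_eq, fourierHat_trigPoly, ite_mul, zero_mul]
  rw [← Finset.sum_filter]
  refine Finset.sum_congr ?_ fun _ _ => rfl
  ext k
  simp only [Finset.mem_filter]
  exact ⟨fun h => h.2, fun h => ⟨hs h, h⟩⟩

/-! ### Positivity of the Fejér kernel -/

theorem sum_Icc_succ {M : Type*} [AddCommMonoid M] (g : ℤ → M) (n : ℕ) :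
    ∑ k ∈ Finset.Icc (-((n + 1 : ℕ) : ℤ)) (n + 1 : ℕ), g k =
      (∑ k ∈ Finset.Icc (-(n : ℤ)) n, g k) + (g (n + 1 : ℕ) + g (-((n + 1 : ℕ) : ℤ))) := by
  have h : Finset.Icc (-((n + 1 : ℕ) : ℤ)) (n + 1 : ℕ) =
      insert ((n + 1 : ℕ) : ℤ) (insert (-((n + 1 : ℕ) : ℤ)) (Finset.Icc (-(n : ℤ)) n)) := by
    ext k; simp only [Finset.mem_insert, Finset.mem_Icc]; push_cast; omega
  rw [h, Finset.sum_insert, Finset.sum_insert]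
  · rw [← add_assoc, add_comm]
  · simp only [Finset.mem_Icc]; push_cast; omega
  · simp only [Finset.mem_insert, Finset.mem_Icc]; push_cast; omega

/-- With `A_n = ∑_{j<n} e^{ijx}`, the right side is the increment `|A_{n+1}|² - |A_n|²`, so that
summing Dirichlet kernels telescopes to a square. -/
theorem dirichlet_eq_geom (n : ℕ) (x : ℝ) :
    ∑ k ∈ Finset.Icc (-(n : ℤ)) n, wave k x =
      wave n x * (∑ j ∈ Finset.range (n + 1), wave (-(j : ℤ)) x) +
        wave (-(n : ℤ)) x * ∑ j ∈ Finset.range n, wave j x := by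
  induction n with
  | zero => simp [wave_zero]
  | succ n ih =>
    rw [sum_Icc_succ (fun k => wave k x), ih, Finset.sum_range_succ' _ (n + 1),
      Finset.sum_range_succ' (fun j : ℕ => wave (j : ℤ) x) n]
    have e1 : ∀ j : ℕ, wave (-((j + 1 : ℕ) : ℤ)) x = wave (-1) x * wave (-(j : ℤ)) x := fun j => by
      rw [← wave_add]; push_cast; ring_nf
    have e2 : ∀ j : ℕ, wave ((j + 1 : ℕ) : ℤ) x = wave 1 x * wave (j : ℤ) x := fun j => by
      rw [← wave_add]; push_cast; ring_nf
    have e3 : wave 1 x * wave (-1) x = 1 := by rw [← wave_add]; exact wave_zero x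
    have e0 : wave (-((0 : ℕ) : ℤ)) x = 1 := by simp [wave_zero]
    have e4 : wave ((0 : ℕ) : ℤ) x = 1 := by simp [wave_zero]
    simp only [e1, e2, ← Finset.mul_sum, e0, e4]
    linear_combination (-wave n x * (∑ j ∈ Finset.range (n + 1), wave (-(j : ℤ)) x) -
        wave (-(n : ℤ)) x * ∑ j ∈ Finset.range n, wave j x) * e3

theorem sum_dirichlet_eq_normSq (N : ℕ) (x : ℝ) :
    ∑ m ∈ Finset.range N, ∑ k ∈ Finset.Icc (-(m : ℤ)) m, wave k x =
      (Complex.normSq (∑ j ∈ Finset.range N, wave j x) : ℂ) := by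
  rw [Complex.normSq_eq_conj_mul_self, map_sum]
  simp only [conj_wave]
  induction N with
  | zero => simp
  | succ N ih =>
    rw [Finset.sum_range_succ, ih, dirichlet_eq_geom, Finset.sum_range_succ,
      Finset.sum_range_succ (fun j : ℕ => wave (j : ℤ) x)]
    ring

theorem sum_partialSum_eq_integral {g : ℝ → ℂ}
    (hg : IntervalIntegrable g volume (-Real.pi) Real.pi) (N : ℕ) (x : ℝ) :
    ∑ m ∈ Finset.range N, partialSum g m x = (1 / (2 * Real.pi) : ℂ) *
      ∫ t in (-Real.pi)..Real.pi,
        g t * (Complex.normSq (∑ j ∈ Finset.range N, wave j (x - t)) : ℂ) := by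
  simp only [← sum_dirichlet_eq_normSq, Finset.mul_sum]
  have hi : ∀ k : ℤ, IntervalIntegrable (fun t => g t * wave k (x - t)) volume
      (-Real.pi) Real.pi := fun k =>
    hg.mul_continuousOn ((continuous_wave k).comp (continuous_sub_left x)).continuousOn
  rw [intervalIntegral.integral_finsetSum fun m _ =>
    intervalIntegrable_sum _ fun k _ => hi k, Finset.mul_sum]
  refine Finset.sum_congr rfl fun m _ => ?_
  rw [intervalIntegral.integral_finsetSum fun k _ => hi k, Finset.mul_sum, partialSum_eq]
  refine Finset.sum_congr rfl fun k _ => ?_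
  rw [fourierHat_eq_wave, mul_assoc, ← intervalIntegral.integral_mul_const]
  congr 2
  ext t
  rw [wave_sub_right]; ring

/-- The summed kernel is nonnegative, so absolute values pass inside the convolution onto `g`. -/
theorem norm_sum_partialSum_le {g : ℝ → ℂ}
    (hg : IntervalIntegrable g volume (-Real.pi) Real.pi) (N : ℕ) (x : ℝ) :
    ‖∑ m ∈ Finset.range N, partialSum g m x‖ ≤
      (∑ m ∈ Finset.range N, partialSum (fun t => (‖g t‖ : ℂ)) m x).re := by
  have hg' : IntervalIntegrable (fun t => (‖g t‖ : ℂ)) volume (-Real.pi) Real.pi := by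
    rw [intervalIntegrable_iff] at *
    exact hg.norm.ofReal
  rw [sum_partialSum_eq_integral hg, sum_partialSum_eq_integral hg']
  simp only [← Complex.ofReal_mul, intervalIntegral.integral_ofReal]
  have h1 : (1 / (2 * Real.pi) : ℂ) = ((1 / (2 * Real.pi) : ℝ) : ℂ) := by push_cast; ring
  rw [h1, ← Complex.ofReal_mul, Complex.ofReal_re, norm_mul, Complex.norm_real,
    Real.norm_of_nonneg (by positivity)]
  refine mul_le_mul_of_nonneg_left ?_ (by positivity)
  refine (intervalIntegral.norm_integral_le_integral_norm neg_pi_le_pi).trans_eq ?_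
  congr 1
  ext t
  rw [norm_mul, Complex.norm_real, Real.norm_of_nonneg (Complex.normSq_nonneg _)]

theorem integral_partialSum (g : ℝ → ℂ) (n : ℕ) :
    ∫ x in (-Real.pi)..Real.pi, partialSum g n x = 2 * Real.pi * fourierHat g 0 := by
  simp only [partialSum_eq]
  rw [intervalIntegral.integral_finsetSum fun j _ => Continuous.intervalIntegrable
    (by fun_prop) _ _]
  simp only [intervalIntegral.integral_const_mul, integral_wave, mul_ite, mul_zero,
    Finset.sum_ite_eq']
  rw [if_pos (by simp)]
  ring

/-- Integrating the pointwise domination suffices: every `S_m |g|` has the same integral over the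
period as `|g|`. -/
theorem normL_sum_partialSum_le {g : ℝ → ℂ}
    (hg : IntervalIntegrable g volume (-Real.pi) Real.pi) (N : ℕ) :
    normL (fun x => ∑ m ∈ Finset.range N, partialSum g m x) ≤ N * normL g := by
  have hc : ∀ h : ℝ → ℂ, Continuous fun x => ∑ m ∈ Finset.range N, partialSum h m x := fun h =>
    continuous_finsetSum _ fun m _ => continuous_partialSum h m
  have h1 : normL (fun x => ∑ m ∈ Finset.range N, partialSum g m x) ≤
      ∫ x in (-Real.pi)..Real.pi,
        (∑ m ∈ Finset.range N, partialSum (fun t => (‖g t‖ : ℂ)) m x).re :=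
    intervalIntegral.integral_mono_on neg_pi_le_pi ((hc g).norm.intervalIntegrable _ _)
      ((Complex.continuous_re.comp (hc _)).intervalIntegrable _ _)
      fun x _ => norm_sum_partialSum_le hg N x
  refine h1.trans_eq ?_
  have h2 := Complex.reCLM.intervalIntegral_comp_comm
    ((hc fun t => (‖g t‖ : ℂ)).intervalIntegrable (μ := volume) (-Real.pi) Real.pi)
  simp only [Complex.reCLM_apply] at h2
  rw [h2, intervalIntegral.integral_finsetSum fun m _ =>
    (continuous_partialSum _ m).intervalIntegrable _ _]
  simp only [integral_partialSum, Finset.sum_const, Finset.card_range, nsmul_eq_mul]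
  rw [fourierHat_eq_wave]
  simp only [neg_zero, wave_zero, mul_one, intervalIntegral.integral_ofReal]
  rw [← mul_assoc (2 * (Real.pi : ℂ)), mul_one_div_cancel (by simp), one_mul]
  rw [← Complex.ofReal_natCast, ← Complex.ofReal_mul, Complex.ofReal_re]
  rfl

theorem normL_sum_Ico_partialSum_le {g : ℝ → ℂ}
    (hg : IntervalIntegrable g volume (-Real.pi) Real.pi) (n : ℕ) :
    normL (fun x => ∑ m ∈ Finset.Ico n (2 * n), partialSum g m x) ≤ 3 * n * normL g := by
  have hc : ∀ N, Continuous fun x => ∑ m ∈ Finset.range N, partialSum g m x := fun N =>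
    continuous_finsetSum _ fun m _ => continuous_partialSum g m
  simp only [Finset.sum_Ico_eq_sub _ (by omega : n ≤ 2 * n)]
  have h := normL_sub_le ((hc (2 * n)).intervalIntegrable (-Real.pi) Real.pi)
    ((hc n).intervalIntegrable (-Real.pi) Real.pi)
  have h1 := normL_sum_partialSum_le hg (2 * n)
  have h2 := normL_sum_partialSum_le hg n
  push_cast at h1
  linarith

/-! ### Density of trigonometric polynomials and the delayed means -/

theorem exists_trigPoly_normL_sub_le {f : ℝ → ℂ}
    (hf : IntervalIntegrable f volume (-Real.pi) Real.pi) {ε : ℝ} (hε : 0 < ε) :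
    ∃ (n : ℕ) (T : ℝ → ℂ), Continuous T ∧ (∀ m ≥ n, ∀ x, partialSum T m x = T x) ∧
      normL (fun x => f x - T x) ≤ ε := by
  have hT : Fact (0 < 2 * Real.pi) := ⟨Real.two_pi_pos⟩
  have hend : -Real.pi + 2 * Real.pi = Real.pi := by ring
  set F : AddCircle (2 * Real.pi) → ℂ := AddCircle.liftIoc (2 * Real.pi) (-Real.pi) f with hF
  have hFint : Integrable F := by
    rw [← memLp_one_iff_integrable]
    refine MemLp.memLp_liftIoc ?_
    rw [hend, memLp_one_iff_integrable]
    exact (intervalIntegrable_iff_integrableOn_Ioc_of_le neg_pi_le_pi).1 hf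
  obtain ⟨g, hg, hgi⟩ := hFint.exists_boundedContinuous_integral_sub_le (half_pos hε)
  -- Uniform error `ε / (4π)` on a circle of length `2π` costs `ε / 2` in `L¹`; the other half goes
  -- to the continuous approximation `g`.
  have hδ : 0 < ε / (4 * Real.pi) := by positivity
  have hmem : g.toContinuousMap ∈ closure
      (Submodule.span ℂ (Set.range (@fourier (2 * Real.pi))) : Set C(AddCircle (2 * Real.pi), ℂ)) := by
    rw [← Submodule.topologicalClosure_coe, span_fourier_closure_eq_top]; trivial
  obtain ⟨p, hp, hgp⟩ := Metric.mem_closure_iff.1 hmem _ hδ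
  obtain ⟨a, ha⟩ := Finsupp.mem_span_range_iff_exists_finsupp.1 hp
  have hpx : ∀ x : ℝ, p (x : AddCircle (2 * Real.pi)) = ∑ k ∈ a.support, a k * wave k x := by
    intro x
    rw [← ha, Finsupp.sum, ContinuousMap.sum_apply]
    refine Finset.sum_congr rfl fun k _ => ?_
    rw [ContinuousMap.smul_apply, fourier_coe_apply, smul_eq_mul, wave]
    congr 2
    have hpi : (Real.pi : ℂ) ≠ 0 := by exact_mod_cast Real.pi_ne_zero
    push_cast
    field_simp
  refine ⟨a.support.sup Int.natAbs, fun x => ∑ k ∈ a.support, a k * wave k x, by fun_prop,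
    fun m hm x => ?_, ?_⟩
  · refine partialSum_trigPoly (fun k hk => ?_) a x
    have := (Finset.le_sup (f := Int.natAbs) hk).trans hm
    rw [Finset.mem_Icc]; omega
  · have h1 : normL (fun x => f x - ∑ k ∈ a.support, a k * wave k x) =
        ∫ y : AddCircle (2 * Real.pi), ‖F y - p y‖ := by
      rw [← AddCircle.intervalIntegral_preimage (2 * Real.pi) (-Real.pi), hend, normL]
      refine intervalIntegral.integral_congr_ae (.of_forall fun x hx => ?_)
      rw [Set.uIoc_of_le neg_pi_le_pi] at hx
      rw [hF, AddCircle.liftIoc_coe_apply (by rwa [hend]), hpx]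
    have hpi : Integrable (fun y => p y) :=
      p.continuous.integrable_of_hasCompactSupport (HasCompactSupport.of_compactSpace _)
    rw [h1]
    have h2 : ∫ y : AddCircle (2 * Real.pi), ‖F y - p y‖ ≤
        ∫ y : AddCircle (2 * Real.pi), (‖F y - g y‖ + ε / (4 * Real.pi)) := by
      refine integral_mono (hFint.sub hpi).norm
        ((hFint.sub hgi).norm.add (integrable_const _)) fun y => ?_
      have h3 : ‖g y - p y‖ ≤ ε / (4 * Real.pi) := by
        have := (ContinuousMap.dist_apply_le_dist (f := g.toContinuousMap) (g := p) y).trans hgp.le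
        rwa [dist_eq_norm] at this
      calc ‖F y - p y‖ = ‖(F y - g y) + (g y - p y)‖ := by ring_nf
        _ ≤ ‖F y - g y‖ + ‖g y - p y‖ := norm_add_le _ _
        _ ≤ _ := by gcongr
    have hFg : Integrable (fun y => ‖F y - g y‖) := (hFint.sub hgi).norm
    rw [integral_add hFg (integrable_const _), integral_const] at h2
    have h4 : (volume : Measure (AddCircle (2 * Real.pi))).real Set.univ = 2 * Real.pi := by
      rw [measureReal_def, AddCircle.measure_univ, ENNReal.toReal_ofReal Real.two_pi_pos.le]
    rw [h4, smul_eq_mul] at h2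
    have h5 : 2 * Real.pi * (ε / (4 * Real.pi)) = ε / 2 := by
      have := Real.pi_ne_zero
      field_simp; ring
    linarith

/-- The factor `4` is `1 + 3`: one for `f - T` itself, three for the mean of `S_m (f - T)` as a
difference of sums over `m < 2n` and `m < n`. -/
theorem normL_sub_partialSum_le {f T : ℝ → ℂ}
    (hf : IntervalIntegrable f volume (-Real.pi) Real.pi) (hT : Continuous T) {n : ℕ} (hn : 1 ≤ n)
    (hTn : ∀ m ≥ n, ∀ x, partialSum T m x = T x) {A : ℝ}
    (hA : ∀ m, n ≤ m → m ≤ 2 * n →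
      normL (fun x => partialSum f m x - partialSum f n x) ≤ A) :
    normL (fun x => f x - partialSum f n x) ≤ 4 * normL (fun x => f x - T x) + A := by
  have hTi : IntervalIntegrable T volume (-Real.pi) Real.pi := hT.intervalIntegrable _ _
  have hh := hf.sub hTi
  have hcard : (Finset.Ico n (2 * n)).card = n := by simp; omega
  have hid : ∀ x, (n : ℂ) * (f x - partialSum f n x) =
      ((n : ℂ) * (f x - T x) - ∑ m ∈ Finset.Ico n (2 * n), partialSum (fun x => f x - T x) m x) +
      ∑ m ∈ Finset.Ico n (2 * n), (partialSum f m x - partialSum f n x) := by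
    intro x
    have : ∑ m ∈ Finset.Ico n (2 * n), partialSum (fun x => f x - T x) m x =
        ∑ m ∈ Finset.Ico n (2 * n), (partialSum f m x - T x) := by
      refine Finset.sum_congr rfl fun m hm => ?_
      rw [partialSum_sub hf hTi, hTn m (Finset.mem_Ico.1 hm).1]
    rw [this, Finset.sum_sub_distrib, Finset.sum_sub_distrib, Finset.sum_const, Finset.sum_const,
      hcard]
    simp only [nsmul_eq_mul]
    ring
  have hc : ∀ (h : ℝ → ℂ) m, IntervalIntegrable (partialSum h m) volume (-Real.pi) Real.pi :=
    fun h m => (continuous_partialSum h m).intervalIntegrable _ _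
  have h0 : normL (fun x => (n : ℂ) * (f x - partialSum f n x)) =
      n * normL (fun x => f x - partialSum f n x) := by
    rw [normL_const_mul]; simp
  have h0' : normL (fun x => (n : ℂ) * (f x - T x)) = n * normL (fun x => f x - T x) := by
    rw [normL_const_mul]; simp
  have i1 := intervalIntegrable_sum (Finset.Ico n (2 * n)) fun m _ => hc (fun x => f x - T x) m
  have i2 := intervalIntegrable_sum (Finset.Ico n (2 * n)) fun m _ => (hc f m).sub (hc f n)
  have h1 := normL_add_le ((hh.const_mul (n : ℂ)).sub i1) i2
  have h2 := normL_sub_le (hh.const_mul (n : ℂ)) i1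
  have h3 := normL_sum_Ico_partialSum_le hh n
  have h4 := normL_sum_le (Finset.Ico n (2 * n)) fun m _ => (hc f m).sub (hc f n)
  have h5 : ∑ m ∈ Finset.Ico n (2 * n), normL (fun x => partialSum f m x - partialSum f n x) ≤
      n * A := by
    have := Finset.sum_le_card_nsmul (Finset.Ico n (2 * n)) _ A fun m hm =>
      hA m (Finset.mem_Ico.1 hm).1 (Finset.mem_Ico.1 hm).2.le
    rwa [hcard, nsmul_eq_mul] at this
  simp only [hid] at h0
  have hn0 : (0 : ℝ) < n := by exact_mod_cast hn
  refine le_of_mul_le_mul_left ?_ hn0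
  rw [← h0]
  refine h1.trans ?_
  have h4' := h4.trans h5
  refine (add_le_add h2 h4').trans ?_
  rw [h0']
  linarith

/-- If the blocks `S_m - S_n`, `n ≤ m ≤ 2n`, are uniformly small in `L¹`, then the partial sums
converge in `L¹`. -/
theorem tendsto_normL_of_blocks {f : ℝ → ℂ}
    (hf : IntervalIntegrable f volume (-Real.pi) Real.pi) {A : ℕ → ℝ} (hA : Tendsto A atTop (𝓝 0))
    (hfA : ∀ᶠ n in atTop, ∀ m, n ≤ m → m ≤ 2 * n →
      normL (fun x => partialSum f m x - partialSum f n x) ≤ A n) :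
    Tendsto (fun n : ℕ => normL (fun x : ℝ => f x - partialSum f n x)) atTop (𝓝 0) := by
  rw [Metric.tendsto_atTop']
  intro ε hε
  -- The factor `4` turns `ε / 8` into `ε / 2`.
  obtain ⟨N, T, hT, hTN, hfT⟩ := exists_trigPoly_normL_sub_le hf (show 0 < ε / 8 by positivity)
  have hev := (hA.eventually_lt_const (half_pos hε)).and (hfA.and
    ((eventually_ge_atTop N).and (eventually_ge_atTop 1)))
  obtain ⟨M, hM⟩ := eventually_atTop.1 hev
  refine ⟨M, fun n hn => ?_⟩
  obtain ⟨h1, h2, h3, h4⟩ := hM n hn.le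
  have := normL_sub_partialSum_le hf hT h4 (fun m hm => hTN m (h3.trans hm)) h2
  rw [Real.dist_0_eq_abs, abs_of_nonneg (normL_nonneg _)]
  linarith

/-! ### The `L¹` norm of geometric sums of exponentials -/

theorem norm_sum_wave_le (p : ℕ) (x : ℝ) : ‖∑ j ∈ Finset.range p, wave j x‖ ≤ p := by
  refine (norm_sum_le _ _).trans_eq ?_
  simp [norm_wave]

/-- Geometric sum: the numerator is at most `2`, and `|e^{ix} - 1| = 2 |sin (x/2)| ≥ 2x/π` by
Jordan's inequality. -/
theorem mul_norm_sum_wave_le (p : ℕ) {x : ℝ} (hx0 : 0 ≤ x) (hx : x ≤ Real.pi) :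
    x * ‖∑ j ∈ Finset.range p, wave j x‖ ≤ Real.pi := by
  have hpi := Real.pi_pos
  have h1 : (Complex.exp (Complex.I * x) - 1) * ∑ j ∈ Finset.range p, wave j x =
      Complex.exp (Complex.I * x) ^ p - 1 := by
    simp only [wave_natCast]
    rw [mul_comm, geom_sum_mul]
  have h2 : ‖Complex.exp (Complex.I * x) ^ p - 1‖ ≤ 2 := by
    rw [← wave_natCast]
    refine (norm_sub_le _ _).trans_eq ?_
    rw [norm_wave, norm_one]; norm_num
  rw [← h1, norm_mul, Complex.norm_exp_I_mul_ofReal_sub_one, Real.norm_eq_abs] at h2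
  have h3 := Real.mul_le_sin (x := x / 2) (by linarith) (by linarith)
  have h4 : 2 / Real.pi * x ≤ |2 * Real.sin (x / 2)| := by
    refine le_trans ?_ (le_abs_self _)
    linarith
  have h5 : 2 / Real.pi * x * ‖∑ j ∈ Finset.range p, wave j x‖ ≤ 2 :=
    (mul_le_mul_of_nonneg_right h4 (norm_nonneg _)).trans h2
  calc x * ‖∑ j ∈ Finset.range p, wave j x‖
      = Real.pi / 2 * (2 / Real.pi * x * ‖∑ j ∈ Finset.range p, wave j x‖) := by field_simp
    _ ≤ Real.pi / 2 * 2 := by gcongr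
    _ = Real.pi := by ring

/-- Adding the bounds `p` and `π / x`, after clearing denominators, gives one majorant with a
logarithmic antiderivative; the integral need not be split at `1/p`. -/
theorem norm_sum_wave_le_div (p : ℕ) {x : ℝ} (hx0 : 0 ≤ x) (hx : x ≤ Real.pi) :
    ‖∑ j ∈ Finset.range p, wave j x‖ ≤ 2 * Real.pi * (p / (p * x + Real.pi)) := by
  have hpi := Real.pi_pos
  have hd : 0 < p * x + Real.pi := by positivity
  rw [← mul_div_assoc, le_div_iff₀ hd]
  have h1 := mul_le_mul_of_nonneg_left (mul_norm_sum_wave_le p hx0 hx) (Nat.cast_nonneg (α := ℝ) p)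
  have h2 := mul_le_mul_of_nonneg_left (norm_sum_wave_le p x) hpi.le
  linarith

theorem integral_zero_pi_norm_sum_wave_le (p : ℕ) :
    ∫ x in (0 : ℝ)..Real.pi, ‖∑ j ∈ Finset.range p, wave j x‖ ≤
      2 * Real.pi * Real.log (p + 1) := by
  have hpi := Real.pi_pos
  have hpos : ∀ x ∈ Set.uIcc 0 Real.pi, 0 < p * x + Real.pi := fun x hx => by
    rw [Set.uIcc_of_le hpi.le] at hx
    have := hx.1
    positivity
  have hci : IntervalIntegrable (fun x : ℝ => 2 * Real.pi * (p / (p * x + Real.pi))) volume 0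
      Real.pi :=
    ContinuousOn.intervalIntegrable <| continuousOn_const.mul <|
      continuousOn_const.div (by fun_prop) fun x hx => (hpos x hx).ne'
  refine (intervalIntegral.integral_mono_on hpi.le (Continuous.intervalIntegrable (by fun_prop) _ _)
    hci fun x hx => norm_sum_wave_le_div p hx.1 hx.2).trans_eq ?_
  have hd : ∀ x ∈ Set.uIcc 0 Real.pi,
      HasDerivAt (fun x : ℝ => 2 * Real.pi * Real.log (p * x + Real.pi))
        (2 * Real.pi * (p / (p * x + Real.pi))) x := fun x hx => by
    have h := ((hasDerivAt_id x).const_mul (p : ℝ)).add_const Real.pi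
    simpa using (h.log (hpos x hx).ne').const_mul (2 * Real.pi)
  rw [intervalIntegral.integral_eq_sub_of_hasDerivAt hd hci]
  have : (p : ℝ) * Real.pi + Real.pi = (p + 1) * Real.pi := by ring
  rw [this, Real.log_mul (by positivity) hpi.ne']
  simp only [mul_zero, zero_add]
  ring

theorem normL_comp_neg (g : ℝ → ℂ) : normL (fun x => g (-x)) = normL g := by
  unfold normL
  rw [intervalIntegral.integral_comp_neg fun x => ‖g x‖]
  simp

theorem normL_sum_wave_le (p : ℕ) :
    normL (fun x => ∑ j ∈ Finset.range p, wave j x) ≤ 4 * Real.pi * Real.log (p + 1) := by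
  have h1 := integral_zero_pi_norm_sum_wave_le p
  have hc : Continuous fun x => ‖∑ j ∈ Finset.range p, wave j x‖ := by fun_prop
  have h2 : ∫ x in (-Real.pi)..0, ‖∑ j ∈ Finset.range p, wave j x‖ =
      ∫ x in (0 : ℝ)..Real.pi, ‖∑ j ∈ Finset.range p, wave j x‖ := by
    have h := intervalIntegral.integral_comp_neg (a := 0) (b := Real.pi)
      fun x => ‖∑ j ∈ Finset.range p, wave j x‖
    rw [neg_zero] at h
    rw [← h]
    refine intervalIntegral.integral_congr fun x _ => ?_
    simp only [wave_neg_right, ← conj_wave, ← map_sum, RCLike.norm_conj]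
  rw [normL, ← intervalIntegral.integral_add_adjacent_intervals (hc.intervalIntegrable _ 0)
    (hc.intervalIntegrable 0 _), h2]
  linarith

/-! ### Abel summation and the `L¹` norm of dyadic blocks -/

theorem sum_mul_wave_by_parts (a : ℕ → ℂ) (p : ℕ) (x : ℝ) :
    ∑ j ∈ Finset.range (p + 1), a j * wave j x =
      a p * (∑ i ∈ Finset.range (p + 1), wave i x) +
        ∑ j ∈ Finset.range p, (a j - a (j + 1)) * ∑ i ∈ Finset.range (j + 1), wave i x := by
  induction p with
  | zero => simp
  | succ p ih =>
    rw [Finset.sum_range_succ _ (p + 1), ih,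
      Finset.sum_range_succ (fun j => (a j - a (j + 1)) * _) p,
      Finset.sum_range_succ (fun i : ℕ => wave i x) (p + 1)]
    ring

theorem normL_sum_mul_wave_le (a : ℕ → ℂ) (p : ℕ) :
    normL (fun x => ∑ j ∈ Finset.range (p + 1), a j * wave j x) ≤
      (‖a p‖ + ∑ j ∈ Finset.range p, ‖a j - a (j + 1)‖) *
        (4 * Real.pi * Real.log (p + 2)) := by
  simp only [sum_mul_wave_by_parts]
  have hG : ∀ j ≤ p, normL (fun x => ∑ i ∈ Finset.range (j + 1), wave i x) ≤
      4 * Real.pi * Real.log (p + 2) := fun j hj => by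
    refine (normL_sum_wave_le (j + 1)).trans ?_
    have : (j : ℝ) ≤ p := by exact_mod_cast hj
    have hpi := Real.pi_pos
    refine mul_le_mul_of_nonneg_left (Real.log_le_log (by positivity) ?_) (by positivity)
    push_cast; linarith
  refine (normL_add_le (Continuous.intervalIntegrable (by fun_prop) _ _)
    (Continuous.intervalIntegrable (by fun_prop) _ _)).trans ?_
  rw [normL_const_mul, add_mul, Finset.sum_mul]
  refine add_le_add (mul_le_mul_of_nonneg_left (hG p le_rfl) (norm_nonneg _)) ?_
  refine (normL_sum_le _ fun j _ => Continuous.intervalIntegrable (by fun_prop) _ _).trans ?_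
  refine Finset.sum_le_sum fun j hj => ?_
  rw [normL_const_mul]
  exact mul_le_mul_of_nonneg_left (hG j (Finset.mem_range.1 hj).le) (norm_nonneg _)

theorem norm_le_add_sum_Ico (c : ℕ → ℂ) {m n : ℕ} (hmn : m ≤ n) :
    ‖c n‖ ≤ ‖c m‖ + ∑ k ∈ Finset.Ico m n, ‖c k - c (k + 1)‖ := by
  induction n, hmn using Nat.le_induction with
  | base => simp
  | succ n hmn ih =>
    rw [Finset.sum_Ico_succ_top hmn]
    have := norm_sub_norm_le (c (n + 1)) (c n)
    rw [norm_sub_rev] at this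
    linarith

/-- Factoring out the unimodular `e^{i(n+1)x}` reduces to a sum starting at frequency `0`. The
variation counts twice: once in the Abel sum, once in bounding the last coefficient by `‖c n‖`. -/
theorem normL_block_le {c : ℕ → ℂ} {n m : ℕ} (hnm : n ≤ m) (hm : m ≤ 2 * n) :
    normL (fun x => ∑ k ∈ Finset.Ioc n m, c k * wave k x) ≤
      (‖c n‖ + 2 * ∑ k ∈ Finset.Icc n (2 * n), ‖c k - c (k + 1)‖) *
        (4 * Real.pi * Real.log (n + 1)) := by
  have hpi := Real.pi_pos
  have hB : 0 ≤ ∑ k ∈ Finset.Icc n (2 * n), ‖c k - c (k + 1)‖ :=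
    Finset.sum_nonneg fun _ _ => norm_nonneg _
  have hlog : 0 ≤ Real.log (n + 1) := Real.log_nonneg (by simp)
  -- The empty block; it includes `n = 0`, where `m ≤ 2 * n` forces `m = n`.
  rcases hnm.eq_or_lt with rfl | hlt
  · simp only [Finset.Ioc_self, Finset.sum_empty, normL, norm_zero,
      intervalIntegral.integral_zero]
    positivity
  obtain ⟨p, rfl⟩ : ∃ p, m = n + 1 + p := ⟨m - (n + 1), by omega⟩
  have hsum : ∀ x, ∑ k ∈ Finset.Ioc n (n + 1 + p), c k * wave k x =
      wave (n + 1 : ℕ) x * ∑ j ∈ Finset.range (p + 1), c (n + 1 + j) * wave j x := by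
    intro x
    have : Finset.Ioc n (n + 1 + p) = Finset.Ico (n + 1) (n + 1 + (p + 1)) := by
      ext k; simp only [Finset.mem_Ioc, Finset.mem_Ico]; omega
    rw [this, Finset.sum_Ico_eq_sum_range, Finset.mul_sum]
    refine Finset.sum_congr (by congr 1; omega) fun j _ => ?_
    rw [Nat.cast_add (n + 1) j, wave_add]; ring
  have hnorm : normL (fun x => ∑ k ∈ Finset.Ioc n (n + 1 + p), c k * wave k x) =
      normL (fun x => ∑ j ∈ Finset.range (p + 1), c (n + 1 + j) * wave j x) := by
    simp only [normL, hsum, norm_mul, norm_wave, one_mul]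
  rw [hnorm]
  refine (normL_sum_mul_wave_le (fun j => c (n + 1 + j)) p).trans ?_
  have h1 : ‖c (n + 1 + p)‖ ≤ ‖c n‖ + ∑ k ∈ Finset.Icc n (2 * n), ‖c k - c (k + 1)‖ := by
    refine (norm_le_add_sum_Ico c (by omega : n ≤ n + 1 + p)).trans ?_
    gcongr
    intro k; simp only [Finset.mem_Ico, Finset.mem_Icc]; omega
  have h2 : ∑ j ∈ Finset.range p, ‖c (n + 1 + j) - c (n + 1 + (j + 1))‖ ≤
      ∑ k ∈ Finset.Icc n (2 * n), ‖c k - c (k + 1)‖ := by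
    have e : ∑ j ∈ Finset.range p, ‖c (n + 1 + j) - c (n + 1 + (j + 1))‖ =
        ∑ k ∈ Finset.Ico (n + 1) (n + 1 + p), ‖c k - c (k + 1)‖ := by
      rw [Finset.sum_Ico_eq_sum_range, Nat.add_sub_cancel_left]; simp only [add_assoc]
    rw [e]
    refine Finset.sum_le_sum_of_subset_of_nonneg ?_ fun _ _ _ => norm_nonneg _
    intro k; simp only [Finset.mem_Ico, Finset.mem_Icc]; omega
  have hpn : ((p : ℝ) + 2) ≤ n + 1 := by
    have : p + 1 ≤ n := by omega
    have : ((p + 1 : ℕ) : ℝ) ≤ n := by exact_mod_cast this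
    push_cast at this; linarith
  refine mul_le_mul (by linarith) ?_ ?_ (by positivity)
  · gcongr
  · have : 0 ≤ Real.log ((p : ℝ) + 2) := Real.log_nonneg (by linarith [Nat.cast_nonneg (α := ℝ) p])
    positivity

/-! ### From coefficients to `L¹` convergence -/

theorem partialSum_sub_partialSum (f : ℝ → ℂ) {n m : ℕ} (hnm : n ≤ m) (x : ℝ) :
    partialSum f m x - partialSum f n x =
      (∑ k ∈ Finset.Ioc n m, fourierHat f k * wave k x) +
        ∑ k ∈ Finset.Ioc n m, fourierHat f (-(k : ℤ)) * wave k (-x) := by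
  simp only [partialSum_eq, wave_neg_right]
  induction m, hnm using Nat.le_induction with
  | base => simp
  | succ m hnm ih =>
    rw [sum_Icc_succ (fun k => fourierHat f k * wave k x), Finset.sum_Ioc_succ_top (by omega),
      Finset.sum_Ioc_succ_top (by omega)]
    linear_combination ih

theorem log_add_one_le {n : ℕ} (hn : 2 ≤ n) : Real.log (n + 1) ≤ 2 * Real.log n := by
  have hn' : (2 : ℝ) ≤ n := by exact_mod_cast hn
  rw [← Real.log_rpow (by linarith)]
  refine Real.log_le_log (by linarith) ?_
  rw [Real.rpow_two]; nlinarith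

theorem NBVS.tendsto_block_bound {c : ℕ → ℂ} (hc : NBVS c)
    (hlog : Tendsto (fun n : ℕ => ‖c n‖ * Real.log n) atTop (𝓝 0)) :
    Tendsto (fun n : ℕ => (‖c n‖ + 2 * ∑ k ∈ Finset.Icc n (2 * n), ‖c k - c (k + 1)‖) *
        (4 * Real.pi * Real.log (n + 1))) atTop (𝓝 0) := by
  obtain ⟨-, K, hK, hcK⟩ := hc
  have hpi := Real.pi_pos
  have h2 : Tendsto (fun n : ℕ => 2 * n) atTop atTop :=
    tendsto_id.const_mul_atTop' (by norm_num)
  have hlim : Tendsto (fun n : ℕ => (1 + 2 * K) * (8 * Real.pi) * (‖c n‖ * Real.log n +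
      ‖c (2 * n)‖ * Real.log (2 * n : ℕ))) atTop (𝓝 0) := by
    simpa using (hlog.add (hlog.comp h2)).const_mul ((1 + 2 * K) * (8 * Real.pi))
  refine squeeze_zero' (.of_forall fun n => ?_) ?_ hlim
  · have : 0 ≤ Real.log ((n : ℝ) + 1) := Real.log_nonneg (by simp)
    have : 0 ≤ ∑ k ∈ Finset.Icc n (2 * n), ‖c k - c (k + 1)‖ :=
      Finset.sum_nonneg fun _ _ => norm_nonneg _
    positivity
  · filter_upwards [eventually_ge_atTop 2] with n hn
    have h3 := log_add_one_le hn
    have hn' : (2 : ℝ) ≤ n := by exact_mod_cast hn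
    have h4 : Real.log n ≤ Real.log (2 * n : ℕ) :=
      Real.log_le_log (by linarith) (by push_cast; linarith)
    have h5 := hcK n (by omega)
    have h7 : 0 ≤ Real.log ((n : ℝ) + 1) := Real.log_nonneg (by linarith)
    have h6 : 0 ≤ Real.log n := Real.log_nonneg (by linarith)
    calc (‖c n‖ + 2 * ∑ k ∈ Finset.Icc n (2 * n), ‖c k - c (k + 1)‖) *
          (4 * Real.pi * Real.log (n + 1))
        ≤ ((1 + 2 * K) * (‖c n‖ + ‖c (2 * n)‖)) * (4 * Real.pi * (2 * Real.log n)) := by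
          gcongr
          nlinarith [norm_nonneg (c n), norm_nonneg (c (2 * n))]
      _ = (1 + 2 * K) * (8 * Real.pi) * (‖c n‖ * Real.log n + ‖c (2 * n)‖ * Real.log n) := by ring
      _ ≤ _ := by gcongr

theorem tendsto_normL_of_tendsto_log {f : ℝ → ℂ}
    (hf : IntervalIntegrable f volume (-Real.pi) Real.pi)
    (hpos : NBVS (fun n : ℕ => fourierHat f (n : ℤ)))
    (hneg : NBVS (fun n : ℕ => fourierHat f (-(n : ℤ))))
    (hp : Tendsto (fun n : ℕ => ‖fourierHat f (n : ℤ)‖ * Real.log n) atTop (𝓝 0))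
    (hn : Tendsto (fun n : ℕ => ‖fourierHat f (-(n : ℤ))‖ * Real.log n) atTop (𝓝 0)) :
    Tendsto (fun n : ℕ => normL (fun x : ℝ => f x - partialSum f n x)) atTop (𝓝 0) := by
  have hA := (hpos.tendsto_block_bound hp).add (hneg.tendsto_block_bound hn)
  rw [add_zero] at hA
  refine tendsto_normL_of_blocks hf hA (.of_forall fun n m hnm hm => ?_)
  simp only [partialSum_sub_partialSum f hnm]
  refine (normL_add_le (Continuous.intervalIntegrable (by fun_prop) _ _)
    (Continuous.intervalIntegrable (by fun_prop) _ _)).trans ?_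
  rw [normL_comp_neg fun x => ∑ k ∈ Finset.Ioc n m, fourierHat f (-(k : ℤ)) * wave k x]
  exact add_le_add (normL_block_le (c := fun n : ℕ => fourierHat f (n : ℤ)) hnm hm)
    (normL_block_le (c := fun n : ℕ => fourierHat f (-(n : ℤ))) hnm hm)

/-! ### From `L¹` convergence to coefficients -/

/-- These integrals make the bounded sawtooth a test function that produces the weights `1/k`. -/
theorem integral_sub_pi_mul_wave {k : ℤ} (hk : k ≠ 0) :
    ∫ x in (0 : ℝ)..2 * Real.pi, ((x : ℂ) - Real.pi) * wave k x =
      2 * Real.pi / (Complex.I * k) := by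
  have hk' : (k : ℂ) ≠ 0 := by exact_mod_cast hk
  have hI := Complex.I_ne_zero
  have hd : ∀ x ∈ Set.uIcc 0 (2 * Real.pi),
      HasDerivAt (fun x : ℝ => (((x : ℂ) - Real.pi) / (Complex.I * k) -
        1 / (Complex.I * k) ^ 2) * wave k x) (((x : ℂ) - Real.pi) * wave k x) x := fun x _ => by
    have h1 : HasDerivAt (fun x : ℝ => ((x : ℂ) - Real.pi) / (Complex.I * k) -
        1 / (Complex.I * k) ^ 2) (1 / (Complex.I * k)) x :=
      (((Complex.ofRealCLM.hasDerivAt (x := x)).sub_const _).div_const _).sub_const _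
    refine (h1.mul (wave_hasDerivAt k x)).congr_deriv ?_
    field_simp
    ring
  rw [intervalIntegral.integral_eq_sub_of_hasDerivAt hd
    (Continuous.intervalIntegrable (by fun_prop) _ _)]
  have h0 : wave k 0 = 1 := by simp [wave]
  have h1 : wave k (2 * Real.pi) = 1 := by
    have := wave_periodic k 0
    rwa [zero_add, h0] at this
  rw [h0, h1]
  push_cast
  ring

/-- Testing a trigonometric polynomial against the bounded function `(x - π) e^{-iMx}`
on `[0, 2π]`. -/
theorem norm_sum_div_le_normL {ι : Type*} (s : Finset ι) (κ : ι → ℤ) (a : ι → ℂ) {M : ℤ}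
    (hM : ∀ i ∈ s, κ i ≠ M) :
    ‖∑ i ∈ s, a i / ((κ i - M : ℤ) : ℂ)‖ ≤
      normL (fun x => ∑ i ∈ s, a i * wave (κ i) x) / 2 := by
  have hpi := Real.pi_pos
  have h1 : ∫ x in (0 : ℝ)..2 * Real.pi,
      ((x : ℂ) - Real.pi) * wave (-M) x * ∑ i ∈ s, a i * wave (κ i) x =
      2 * Real.pi / Complex.I * ∑ i ∈ s, a i / ((κ i - M : ℤ) : ℂ) := by
    simp only [Finset.mul_sum]
    rw [intervalIntegral.integral_finsetSum fun j _ => Continuous.intervalIntegrable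
      (by fun_prop) _ _]
    refine Finset.sum_congr rfl fun i hi => ?_
    have : ∀ x : ℝ, ((x : ℂ) - Real.pi) * wave (-M) x * (a i * wave (κ i) x) =
        a i * (((x : ℂ) - Real.pi) * wave (κ i - M) x) := fun x => by
      rw [sub_eq_add_neg, sub_eq_add_neg (κ i), wave_add]; ring
    simp only [this]
    rw [intervalIntegral.integral_const_mul, integral_sub_pi_mul_wave (sub_ne_zero.2 (hM i hi))]
    field_simp
  have hper : Function.Periodic (fun x => ‖∑ i ∈ s, a i * wave (κ i) x‖) (2 * Real.pi) :=
    fun x => congrArg norm (Finset.sum_congr rfl fun i _ => by rw [wave_periodic (κ i) x])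
  have h2 : ∫ x in (0 : ℝ)..2 * Real.pi, ‖∑ i ∈ s, a i * wave (κ i) x‖ =
      normL (fun x => ∑ i ∈ s, a i * wave (κ i) x) := by
    have := hper.intervalIntegral_add_eq 0 (-Real.pi)
    rw [zero_add] at this
    rw [this, normL]
    congr 1; ring
  have h3 : ‖∫ x in (0 : ℝ)..2 * Real.pi,
      ((x : ℂ) - Real.pi) * wave (-M) x * ∑ i ∈ s, a i * wave (κ i) x‖ ≤
      Real.pi * normL (fun x => ∑ i ∈ s, a i * wave (κ i) x) := by
    rw [← h2, ← intervalIntegral.integral_const_mul]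
    refine (intervalIntegral.norm_integral_le_integral_norm (by positivity)).trans ?_
    refine intervalIntegral.integral_mono_on (by positivity)
      (Continuous.intervalIntegrable (by fun_prop) _ _)
      (Continuous.intervalIntegrable (by fun_prop) _ _) fun x hx => ?_
    rw [norm_mul, norm_mul, norm_wave, mul_one]
    refine mul_le_mul_of_nonneg_right ?_ (norm_nonneg _)
    rw [← Complex.ofReal_sub, Complex.norm_real, Real.norm_eq_abs, abs_le]
    constructor <;> linarith [hx.1, hx.2]
  rw [h1, norm_mul] at h3
  have h4 : ‖2 * (Real.pi : ℂ) / Complex.I‖ = 2 * Real.pi := by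
    simp [abs_of_pos hpi]
  rw [h4] at h3
  rw [le_div_iff₀ two_pos]
  refine le_of_mul_le_mul_left ?_ hpi
  linarith

theorem norm_fourierHat_le_normL_sub {f : ℝ → ℂ}
    (hf : IntervalIntegrable f volume (-Real.pi) Real.pi) {n : ℕ} {k : ℤ}
    (hk : k ∉ Finset.Icc (-(n : ℤ)) n) :
    ‖fourierHat f k‖ ≤ normL (fun x => f x - partialSum f n x) := by
  have h1 : fourierHat (fun x => f x - partialSum f n x) k = fourierHat f k := by
    rw [fourierHat_sub hf ((continuous_partialSum f n).intervalIntegrable _ _)]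
    have := fourierHat_trigPoly (Finset.Icc (-(n : ℤ)) n) (fourierHat f) k
    rw [if_neg hk] at this
    change fourierHat (partialSum f n) k = 0 at this
    rw [this, sub_zero]
  rw [← h1]
  refine (norm_fourierHat_le _ k).trans (mul_le_of_le_one_left (normL_nonneg _) ?_)
  rw [div_le_one (by positivity)]
  linarith [Real.pi_gt_three]

/-- The block `S_{2n} - S_n` is tested at frequency `n`. Its negative frequencies contribute `n`
terms with denominators at least `n` and numerators at most `‖f - S_n f‖`, hence can be subtracted
off. -/
theorem norm_sum_fourierHat_div_le {f : ℝ → ℂ}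
    (hf : IntervalIntegrable f volume (-Real.pi) Real.pi) (n : ℕ) :
    ‖∑ k ∈ Finset.Ioc n (2 * n), fourierHat f k / ((k : ℂ) - n)‖ ≤
      2 * normL (fun x => f x - partialSum f n x) +
        normL (fun x => f x - partialSum f (2 * n) x) := by
  set s := Finset.Ioc n (2 * n)
  have hc : ∀ m, IntervalIntegrable (partialSum f m) volume (-Real.pi) Real.pi := fun m =>
    (continuous_partialSum f m).intervalIntegrable _ _
  -- The two copies of `s` index the frequencies `k` and `-k`.
  have h1 := norm_sum_div_le_normL (s.disjSum s)
    (Sum.elim (fun k : ℕ => (k : ℤ)) fun k : ℕ => -(k : ℤ))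
    (Sum.elim (fun k : ℕ => fourierHat f k) fun k : ℕ => fourierHat f (-(k : ℤ))) (M := n) (by
      simp only [Finset.mem_disjSum]
      rintro i (⟨k, hk, rfl⟩ | ⟨k, hk, rfl⟩) <;>
        simp only [s, Finset.mem_Ioc, Sum.elim_inl, Sum.elim_inr] at hk ⊢ <;> omega)
  simp only [Finset.sum_disjSum, Sum.elim_inl, Sum.elim_inr] at h1
  have h2 : normL (fun x => (∑ k ∈ s, fourierHat f k * wave k x) +
      ∑ k ∈ s, fourierHat f (-(k : ℤ)) * wave (-(k : ℤ)) x) ≤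
      normL (fun x => f x - partialSum f n x) + normL (fun x => f x - partialSum f (2 * n) x) := by
    have := normL_sub_le (hf.sub (hc n)) (hf.sub (hc (2 * n)))
    simp only [← wave_neg_right]
    simp only [sub_sub_sub_cancel_left,
      partialSum_sub_partialSum f (by omega : n ≤ 2 * n)] at this
    exact this
  have h3 : ‖∑ k ∈ s, fourierHat f (-(k : ℤ)) / ((-(k : ℤ) - n : ℤ) : ℂ)‖ ≤
      normL (fun x => f x - partialSum f n x) := by
    have hle : ∀ k ∈ s, ‖fourierHat f (-(k : ℤ)) / ((-(k : ℤ) - n : ℤ) : ℂ)‖ ≤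
        normL (fun x => f x - partialSum f n x) * (1 / n) := fun k hk => by
      rw [Finset.mem_Ioc] at hk
      have hn : (0 : ℝ) < n := by exact_mod_cast (by omega : 0 < n)
      rw [norm_div, div_eq_mul_one_div]
      refine mul_le_mul (norm_fourierHat_le_normL_sub hf ?_) ?_ (by positivity) (normL_nonneg _)
      · rw [Finset.mem_Icc]; omega
      · refine one_div_le_one_div_of_le hn ?_
        rw [Complex.norm_intCast]
        push_cast
        rw [abs_of_nonpos (by linarith [Nat.cast_nonneg (α := ℝ) k])]
        linarith [Nat.cast_nonneg (α := ℝ) k]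
    refine (norm_sum_le_of_le _ hle).trans ?_
    rw [Finset.sum_const, Nat.card_Ioc, nsmul_eq_mul, show 2 * n - n = n by omega]
    -- For `n = 0` the left side is `0`; otherwise the factors `n` and `1 / n` cancel.
    rcases Nat.eq_zero_or_pos n with rfl | hn
    · simpa using normL_nonneg _
    · have : (n : ℝ) ≠ 0 := by positivity
      field_simp; rfl
  have h4 : ∑ k ∈ s, fourierHat f k / ((k : ℂ) - n) =
      ((∑ k ∈ s, fourierHat f k / (((k : ℤ) - n : ℤ) : ℂ)) +
        ∑ k ∈ s, fourierHat f (-(k : ℤ)) / ((-(k : ℤ) - n : ℤ) : ℂ)) -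
      ∑ k ∈ s, fourierHat f (-(k : ℤ)) / ((-(k : ℤ) - n : ℤ) : ℂ) := by
    push_cast; ring
  rw [h4]
  refine (norm_sub_le _ _).trans ?_
  have := normL_nonneg (fun x => f x - partialSum f n x)
  have := normL_nonneg (fun x => f x - partialSum f (2 * n) x)
  linarith

/-! ### Sector condition and logarithmic averaging -/

theorem norm_mul_cos_le_re {z : ℂ} {θ : ℝ} (hθ : θ < Real.pi / 2) (hz : z ∈ sector θ) :
    ‖z‖ * Real.cos θ ≤ z.re := by
  have hz' : |Complex.arg z| ≤ θ := hz
  rw [← Complex.norm_mul_cos_arg z, ← Real.cos_abs z.arg]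
  refine mul_le_mul_of_nonneg_left ?_ (norm_nonneg _)
  exact Real.cos_le_cos_of_nonneg_of_le_pi (abs_nonneg _) (by linarith [Real.pi_pos]) hz'

theorem sum_norm_div_mul_cos_le {c : ℕ → ℂ} {θ : ℝ} (hθ : θ < Real.pi / 2)
    (hc : ∀ n : ℕ, 1 ≤ n → c n ∈ sector θ) (n : ℕ) :
    (∑ k ∈ Finset.Ioc n (2 * n), ‖c k‖ / ((k : ℝ) - n)) * Real.cos θ ≤
      ‖∑ k ∈ Finset.Ioc n (2 * n), c k / ((k : ℂ) - n)‖ := by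
  refine le_trans ?_ (Complex.re_le_norm _)
  rw [Complex.re_sum, Finset.sum_mul]
  refine Finset.sum_le_sum fun k hk => ?_
  rw [Finset.mem_Ioc] at hk
  have hkn : (0 : ℝ) < k - n := sub_pos.2 (by exact_mod_cast hk.1)
  have h1 : ((k : ℂ) - n) = ((k - n : ℝ) : ℂ) := by push_cast; rfl
  rw [h1, Complex.div_ofReal_re, div_mul_eq_mul_div]
  exact div_le_div_of_nonneg_right (norm_mul_cos_le_re hθ (hc k (by omega))) hkn.le

/-- Moving from `c j` to `c n` costs at most the variation over `[j, 2j]`, which the hypothesis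
controls. -/
theorem norm_le_of_mem_Icc {c : ℕ → ℂ} {K : ℝ} (hK : ∀ m : ℕ, 1 ≤ m →
      ∑ n ∈ Finset.Icc m (2 * m), ‖c n - c (n + 1)‖ ≤ K * (‖c m‖ + ‖c (2 * m)‖))
    {j n : ℕ} (hj : 1 ≤ j) (hjn : j ≤ n) (hn : n ≤ 2 * j) :
    ‖c n‖ ≤ (K + 1) * (‖c j‖ + ‖c (2 * j)‖) := by
  have h1 := norm_le_add_sum_Ico c hjn
  have h2 : ∑ k ∈ Finset.Ico j n, ‖c k - c (k + 1)‖ ≤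
      ∑ k ∈ Finset.Icc j (2 * j), ‖c k - c (k + 1)‖ := by
    refine Finset.sum_le_sum_of_subset_of_nonneg ?_ fun _ _ _ => norm_nonneg _
    intro k; simp only [Finset.mem_Ico, Finset.mem_Icc]; omega
  linarith [hK j hj, norm_nonneg (c (2 * j))]

theorem log_add_one_le_sum (M : ℕ) :
    Real.log (M + 1) ≤ ∑ k ∈ Finset.Ioc M (2 * M), 1 / ((k : ℝ) - M) := by
  have h := log_add_one_le_harmonic M
  have e : Finset.Ioc M (2 * M) = Finset.Ico (M + 1) (2 * M + 1) := by
    ext k; simp only [Finset.mem_Ioc, Finset.mem_Ico]; omega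
  rw [e, Finset.sum_Ico_eq_sum_range, show 2 * M + 1 - (M + 1) = M by omega]
  push_cast [harmonic] at h
  refine h.trans_eq (Finset.sum_congr rfl fun i _ => ?_)
  push_cast
  rw [one_div]; congr 1; ring

/-- Since `1/(j - M) = 2/(2j - 2M)`, the left side is twice the even-indexed part of the sum on the
right. -/
theorem sum_norm_double_div_le (c : ℕ → ℂ) (M : ℕ) :
    ∑ j ∈ Finset.Ioc M (2 * M), ‖c (2 * j)‖ / ((j : ℝ) - M) ≤
      2 * ∑ k ∈ Finset.Ioc (2 * M) (2 * (2 * M)), ‖c k‖ / ((k : ℝ) - (2 * M : ℕ)) := by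
  have hinj : Function.Injective fun j : ℕ => 2 * j := fun a b h => by
    simpa using h
  calc ∑ j ∈ Finset.Ioc M (2 * M), ‖c (2 * j)‖ / ((j : ℝ) - M)
      = 2 * ∑ k ∈ (Finset.Ioc M (2 * M)).image (fun j => 2 * j),
          ‖c k‖ / ((k : ℝ) - (2 * M : ℕ)) := by
        rw [Finset.sum_image hinj.injOn, Finset.mul_sum]
        refine Finset.sum_congr rfl fun j hj => ?_
        rw [Finset.mem_Ioc] at hj
        have : (j : ℝ) - M ≠ 0 := sub_ne_zero.2 (by exact_mod_cast hj.1.ne')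
        push_cast
        rw [← mul_sub]
        field_simp
    _ ≤ _ := by
        refine mul_le_mul_of_nonneg_left ?_ two_pos.le
        refine Finset.sum_le_sum_of_subset_of_nonneg ?_ fun k hk _ => ?_
        · intro k
          simp only [Finset.mem_image, Finset.mem_Ioc]
          rintro ⟨j, hj, rfl⟩
          omega
        · rw [Finset.mem_Ioc] at hk
          have : (0 : ℝ) ≤ k - (2 * M : ℕ) := sub_nonneg.2 (by exact_mod_cast hk.1.le)
          positivity

/-- Every `j` with `M < j ≤ 2M` satisfies `j ≤ n ≤ 2j`, so `|c_n|` can be compared with `|c_j| +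
|c_{2j}|` and averaged with weights `1/(j - M)`. -/
theorem norm_mul_log_le {c : ℕ → ℂ} {K : ℝ} (hK0 : 0 < K) (hK : ∀ m : ℕ, 1 ≤ m →
      ∑ n ∈ Finset.Icc m (2 * m), ‖c n - c (n + 1)‖ ≤ K * (‖c m‖ + ‖c (2 * m)‖))
    {M n : ℕ} (h1 : 2 * M ≤ n) (h2 : n ≤ 2 * M + 1) :
    ‖c n‖ * Real.log n ≤ 2 * (K + 1) *
      ((∑ k ∈ Finset.Ioc M (2 * M), ‖c k‖ / ((k : ℝ) - M)) +
        2 * ∑ k ∈ Finset.Ioc (2 * M) (2 * (2 * M)), ‖c k‖ / ((k : ℝ) - (2 * M : ℕ))) := by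
  -- This is `n ≤ 2M + 1 ≤ (M + 1)²`; at `n = 0` the convention `Real.log 0 = 0` applies.
  have hlog : Real.log n ≤ 2 * Real.log (M + 1) := by
    rcases Nat.eq_zero_or_pos n with rfl | hn
    · simpa using Real.log_nonneg (by simp : (1 : ℝ) ≤ M + 1)
    · rw [← Real.log_rpow (by positivity)]
      refine Real.log_le_log (by exact_mod_cast hn) ?_
      have : (n : ℝ) ≤ 2 * M + 1 := by exact_mod_cast h2
      rw [Real.rpow_two]; nlinarith [sq_nonneg (M : ℝ)]
  have hsum : ‖c n‖ * ∑ k ∈ Finset.Ioc M (2 * M), 1 / ((k : ℝ) - M) ≤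
      (K + 1) * ((∑ k ∈ Finset.Ioc M (2 * M), ‖c k‖ / ((k : ℝ) - M)) +
        ∑ k ∈ Finset.Ioc M (2 * M), ‖c (2 * k)‖ / ((k : ℝ) - M)) := by
    rw [← Finset.sum_add_distrib, Finset.mul_sum, Finset.mul_sum]
    refine Finset.sum_le_sum fun j hj => ?_
    rw [Finset.mem_Ioc] at hj
    have hjM : (0 : ℝ) < j - M := sub_pos.2 (by exact_mod_cast hj.1)
    rw [← add_div, mul_one_div, ← mul_div_assoc]
    exact div_le_div_of_nonneg_right
      (norm_le_of_mem_Icc hK (by omega) (by omega) (by omega)) hjM.le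
  have h3 := sum_norm_double_div_le c M
  calc ‖c n‖ * Real.log n ≤ ‖c n‖ * (2 * Real.log (M + 1)) := by gcongr
    _ ≤ ‖c n‖ * (2 * ∑ k ∈ Finset.Ioc M (2 * M), 1 / ((k : ℝ) - M)) := by
        gcongr; exact log_add_one_le_sum M
    _ = 2 * (‖c n‖ * ∑ k ∈ Finset.Ioc M (2 * M), 1 / ((k : ℝ) - M)) := by ring
    _ ≤ 2 * ((K + 1) * ((∑ k ∈ Finset.Ioc M (2 * M), ‖c k‖ / ((k : ℝ) - M)) +
        ∑ k ∈ Finset.Ioc M (2 * M), ‖c (2 * k)‖ / ((k : ℝ) - M))) := by gcongr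
    _ ≤ 2 * ((K + 1) * ((∑ k ∈ Finset.Ioc M (2 * M), ‖c k‖ / ((k : ℝ) - M)) +
        2 * ∑ k ∈ Finset.Ioc (2 * M) (2 * (2 * M)), ‖c k‖ / ((k : ℝ) - (2 * M : ℕ)))) := by gcongr
    _ = _ := by ring

theorem tendsto_log_of_tendsto_normL {f : ℝ → ℂ}
    (hf : IntervalIntegrable f volume (-Real.pi) Real.pi)
    (hpos : NBVS (fun n : ℕ => fourierHat f (n : ℤ)))
    (h : Tendsto (fun n : ℕ => normL (fun x : ℝ => f x - partialSum f n x)) atTop (𝓝 0)) :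
    Tendsto (fun n : ℕ => ‖fourierHat f (n : ℤ)‖ * Real.log n) atTop (𝓝 0) := by
  obtain ⟨⟨θ, hθ0, hθ, hc⟩, K, hK0, hK⟩ := hpos
  have hcos : 0 < Real.cos θ := Real.cos_pos_of_mem_Ioo ⟨by linarith [Real.pi_pos], hθ⟩
  have h2 : Tendsto (fun n : ℕ => 2 * n) atTop atTop :=
    tendsto_id.const_mul_atTop' (by norm_num)
  set H : ℕ → ℝ := fun n =>
    ∑ k ∈ Finset.Ioc n (2 * n), ‖fourierHat f (k : ℤ)‖ / ((k : ℝ) - n) with hH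
  have hH0 : Tendsto H atTop (𝓝 0) := by
    have hlim : Tendsto (fun n : ℕ => (2 * normL (fun x => f x - partialSum f n x) +
        normL (fun x => f x - partialSum f (2 * n) x)) / Real.cos θ) atTop (𝓝 0) := by
      simpa using ((h.const_mul 2).add (h.comp h2)).div_const (Real.cos θ)
    refine squeeze_zero (fun n => Finset.sum_nonneg fun k hk => ?_) (fun n => ?_) hlim
    · rw [Finset.mem_Ioc] at hk
      have : (0 : ℝ) ≤ k - n := sub_nonneg.2 (by exact_mod_cast hk.1.le)
      positivity
    · rw [le_div_iff₀ hcos]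
      exact (sum_norm_div_mul_cos_le hθ hc n).trans (norm_sum_fourierHat_div_le hf n)
  have hdiv : Tendsto (fun n : ℕ => n / 2) atTop atTop :=
    Nat.tendsto_div_const_atTop (by norm_num)
  have hlim : Tendsto (fun n : ℕ => 2 * (K + 1) * (H (n / 2) + 2 * H (2 * (n / 2)))) atTop
      (𝓝 0) := by
    simpa using ((hH0.comp hdiv).add
      ((hH0.comp (h2.comp hdiv)).const_mul 2)).const_mul (2 * (K + 1))
  refine squeeze_zero (fun n => mul_nonneg (norm_nonneg _) (Real.log_natCast_nonneg n))
    (fun n => ?_) hlim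
  exact norm_mul_log_le (c := fun n : ℕ => fourierHat f (n : ℤ)) hK0 hK
    (by omega) (by omega)

/-! ### Reflection -/

theorem fourierHat_comp_neg (f : ℝ → ℂ) (k : ℤ) :
    fourierHat (fun x => f (-x)) k = fourierHat f (-k) := by
  rw [fourierHat_eq_wave, fourierHat_eq_wave]
  congr 1
  have := intervalIntegral.integral_comp_neg (a := -Real.pi) (b := Real.pi)
    fun x => f x * wave k x
  rw [neg_neg] at this
  rw [neg_neg, ← this]
  simp only [wave_neg_right]

theorem partialSum_comp_neg (f : ℝ → ℂ) (n : ℕ) (x : ℝ) :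
    partialSum (fun x => f (-x)) n x = partialSum f n (-x) := by
  simp only [partialSum_eq, fourierHat_comp_neg, wave_neg_right]
  refine Finset.sum_nbij' (fun k => -k) (fun k => -k) ?_ ?_ ?_ ?_ ?_ <;>
    simp only [Finset.mem_Icc] <;> intro k hk
  · omega
  · omega
  · simp
  · simp
  · simp

/-! ### Two-sided limits over the integers and the equivalence -/

theorem norm_mul_log_abs (z : ℂ) (n : ℕ) (s : ℝ) (hs : |s| = n) :
    ‖z * (Real.log |s| : ℂ)‖ = ‖z‖ * Real.log n := by
  rw [hs, norm_mul, Complex.norm_real, Real.norm_of_nonneg (Real.log_natCast_nonneg n)]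

theorem tendsto_mul_log_atTop_iff (a : ℤ → ℂ) :
    Tendsto (fun n : ℤ => a n * (Real.log |(n : ℝ)| : ℂ)) atTop (𝓝 0) ↔
      Tendsto (fun n : ℕ => ‖a n‖ * Real.log n) atTop (𝓝 0) := by
  rw [← Nat.map_cast_int_atTop, tendsto_map'_iff, tendsto_zero_iff_norm_tendsto_zero]
  refine tendsto_congr fun n => ?_
  exact norm_mul_log_abs _ n _ (by simp)

theorem tendsto_mul_log_atBot_iff (a : ℤ → ℂ) :
    Tendsto (fun n : ℤ => a n * (Real.log |(n : ℝ)| : ℂ)) atBot (𝓝 0) ↔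
      Tendsto (fun n : ℕ => ‖a (-(n : ℤ))‖ * Real.log n) atTop (𝓝 0) := by
  rw [← map_neg_atTop, tendsto_map'_iff, ← tendsto_mul_log_atTop_iff fun n => a (-n)]
  refine tendsto_congr fun n => ?_
  simp

theorem theorem5 (f : ℝ → ℂ) (hf : PeriodicIntegrable f)
    (hpos : NBVS (fun n : ℕ => fourierHat f (n : ℤ)))
    (hneg : NBVS (fun n : ℕ => fourierHat f (-(n : ℤ)))) :
    Tendsto (fun n : ℕ => normL (fun x : ℝ => f x - partialSum f n x)) atTop (𝓝 0) ↔
      (Tendsto (fun n : ℤ => fourierHat f n * (Real.log |(n : ℝ)| : ℂ)) atTop (𝓝 0) ∧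
        Tendsto (fun n : ℤ => fourierHat f n * (Real.log |(n : ℝ)| : ℂ)) atBot (𝓝 0)) := by
  rw [tendsto_mul_log_atTop_iff, tendsto_mul_log_atBot_iff]
  refine ⟨fun h => ⟨tendsto_log_of_tendsto_normL hf.2 hpos h, ?_⟩,
    fun h => tendsto_normL_of_tendsto_log hf.2 hpos hneg h.1 h.2⟩
  have hg : IntervalIntegrable (fun x => f (-x)) volume (-Real.pi) Real.pi := by
    simpa using ((IntervalIntegrable.iff_comp_neg (by simp)).1 hf.2).symm
  -- Reflection turns the coefficients at `-n` into those at `n` and preserves `‖f - S_n f‖`, so the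
  -- positive-frequency result applies to `f (-x)`.
  simp only [← fourierHat_comp_neg] at hneg ⊢
  refine tendsto_log_of_tendsto_normL hg hneg (h.congr fun n => ?_)
  simp only [partialSum_comp_neg]
  exact (normL_comp_neg fun x => f x - partialSum f n x).symm
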